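/- All graphs are finite and simple. For a graph $G$ let $\Delta(G)$ and $\delta(G)$ be its maximum and minimum degree, $V_i(G)$ its set of vertices of degree $i$, $\chi'(G)$ its chromatic index, and $\iota(G)=\alpha(G)/|V(G)|$ its independence ratio, where $\alpha(G)$ is the maximum cardinality of an independent set of vertices. For $k\ge 2$, a graph $G$ without isolated vertices is $k$-critical if $\Delta(G)=k$, $\chi'(G)=k+1$ and $\chi'(G-e)=k$ for every $e\in E(G)$. Let $\mathcal C(k)$ be the set of $k$-critical graphs and $\mathcal C=\bigcup_{k\ge 2}\mathcal C(k)$ the set of critical graphs. For $k\ge 2$ and $t\ge 0$ let $\mathcal C(k,t)$ be the set of all $G\in\mathcal C(k)$ such that $\delta(G)\ge k-1$ and such that one can choose, for every $v\in V_{k-1}(G)$, paths $p_1(v),\dots,p_{k-1}(v)$ in $G$ with initial vertex $v$, in such a way that for all $v\in V_{k-1}(G)$ and all $i,j\in\{1,\dots,k-1\}$: (a) $V(p_i(v))\cap V_{k-1}(G)=\{v\}$; (b) $|V(p_i(v))|\ge 2t(k-1)+2$; (c) if $i\ne j$, then $V(p_i(v))\cap V(p_j(v))=\{v\}$; (d)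 if $w\in V_{k-1}(G)$ and $w\ne v$, then $V(p_i(v))\cap V(p_j(w))=\emptyset$. Theorem. For every real $\epsilon>0$ there is an integer $T\ge 0$ such that for every integer $t\ge T$ the set $\mathcal C_\epsilon=\bigcup_{k\ge 2}\mathcal C(k,t)$ of critical graphs has the following two properties: 1. $\iota(G)\le\frac12$ for every $G\in\mathcal C$ if and only if $\iota(G)\le\frac12$ for every $G\in\mathcal C_\epsilon$. 2. $\iota(G)<\frac12+\epsilon$ for every $G\in\mathcal C_\epsilon$. -/

import Mathlib

universe u

noncomputable section

namespace EdgeCritical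

/-- A finite simple graph, bundled with its vertex type. -/
structure FinGraph : Type (u + 1) where
  V : Type u
  [fintypeV : Fintype V]
  graph : SimpleGraph V

attribute [instance] FinGraph.fintypeV

/-- The chromatic index of a graph: the least number of colors in a proper edge coloring, that is,
in a proper vertex coloring of the line graph. -/
def chromaticIndex {V : Type u} (G : SimpleGraph V) : ℕ∞ :=
  G.lineGraph.chromaticNumber

open Classical in
/-- `G` is `k`-critical: `Δ(G) = k`, `χ'(G) = k + 1` and `χ'(G - e) = k` for every edge `e`.
As usual for critical graphs, `k ≥ 2` and isolated vertices are excluded. -/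
def IsCritical {V : Type u} [Fintype V] (G : SimpleGraph V) (k : ℕ) : Prop :=
  2 ≤ k ∧ (∀ v, ∃ w, G.Adj v w) ∧ G.maxDegree = k ∧ chromaticIndex G = k + 1 ∧
    ∀ e ∈ G.edgeSet, chromaticIndex (G.deleteEdges {e}) = k

open Classical in
/-- `V_i(G)`, the set of vertices of degree `i`. -/
def degreeClass {V : Type u} [Fintype V] (G : SimpleGraph V) (i : ℕ) : Set V :=
  {v | G.degree v = i}

/-- The set of vertices of a walk. -/
def walkVerts {V : Type u} {G : SimpleGraph V} {a b : V} (p : G.Walk a b) : Set V :=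
  {x | x ∈ p.support}

/-- Every vertex `v` of degree `k - 1` is the initial vertex of `k - 1` distinguished paths
`p v i`, ending in `z v i`, with the four properties below.
(Walks at vertices `v` of other degrees are irrelevant and may be taken trivial.) -/
def HasDistinguishedPaths {V : Type u} [Fintype V] (G : SimpleGraph V) (k t : ℕ) : Prop :=
  ∃ (z : V → Fin (k - 1) → V) (p : ∀ (v : V) (i : Fin (k - 1)), G.Walk v (z v i)),
    ∀ v ∈ degreeClass G (k - 1),
      (∀ i, (p v i).IsPath) ∧
      (∀ i, walkVerts (p v i) ∩ degreeClass G (k - 1) = {v}) ∧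
      (∀ i, 2 * t * (k - 1) + 2 ≤ (walkVerts (p v i)).ncard) ∧
      (∀ i j, i ≠ j → walkVerts (p v i) ∩ walkVerts (p v j) = {v}) ∧
      (∀ w ∈ degreeClass G (k - 1), w ≠ v →
        ∀ i j, walkVerts (p v i) ∩ walkVerts (p w j) = ∅)

/-- The set `𝒞(k)` of `k`-critical graphs. -/
def criticalClass (k : ℕ) : Set FinGraph.{u} :=
  {G | IsCritical G.graph k}

/-- The set `𝒞` of all critical graphs, the union of the `𝒞(k)` over `k ≥ 2`. -/
def criticalGraphs : Set FinGraph.{u} :=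
  ⋃ k ≥ 2, criticalClass k

open Classical in
/-- The set `𝒞(k, t)`. -/
def criticalPathClass (k t : ℕ) : Set FinGraph.{u} :=
  {G | G ∈ criticalClass k ∧ k - 1 ≤ G.graph.minDegree ∧ HasDistinguishedPaths G.graph k t}

/-- The independence ratio `ι(G) = α(G) / |V(G)|`. -/
def indepRatio (G : FinGraph.{u}) : ℝ :=
  (G.graph.indepNum : ℝ) / (Fintype.card G.V : ℝ)

end EdgeCritical

end

/-!
If a `k`-critical graph `G` has independence ratio above `1 / 2`, then so has its Meredith
extension, in which every vertex `v` is replaced by a copy of `K_{k,k-1}`, the block of `v`, whose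
larger side takes up the edges at `v`, each at a different vertex, its port. An independent set
`I` of `G` gives one with `(k - 1) |V(G)| + |I|` of the `(2 k - 1) |V(G)|` vertices of the extension
(`le_indepNum_meredith`).

The extension is again `k`-critical (`IsCritical.meredith`). In a `k`-edge-coloring of it each color
occurs on `k - 1` edges inside each block, so the edges of `G` at a vertex have different colors and
`G` would be `k`-edge-colorable (`EdgeColorable.of_meredith`). Conversely, a coloring of the edges
between the blocks, proper at each block, extends to the blocks by Latin rectangles. If an edge
inside the block of `v` is deleted, a suitable edge `vw` of `G` is deleted instead, `G - vw` is
colored, and `vw` is given a color missing at `w`. Its conflict at `v` is absorbed by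
the deleted edge, with a Latin rectangle modified in at most one entry
(`exists_defect_rectangle`).

All degrees in an extension are `k - 1` or `k`, and the vertices of degree `k - 1` are the unused
ports. In the extension of a graph of minimum degree at least `k - 1` every block has at most one
of them. Its `k - 1` neighbors in the block have degree `k`, which is the beginning of a system of
disjoint paths (`hasPathSystem_one_meredith`). Each further extension lifts the paths to longer ones
(`HasPathSystem.meredith`), so iterating yields a member of `𝒞(k, t)` with independence ratio
above `1 / 2`.

The bound `1 / 2 + ε` comes from counting the edges between an independent set and its complement:
the excess over `1 / 2` is caused by vertices of degree `k - 1` only (`two_mul_indepNum_le`), and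
they are rare since they start disjoint long paths (`ncard_degreeClass_mul_le`).
-/

namespace EdgeCritical

open Classical SimpleGraph

/-! ### Edge colorings as symmetric functions -/

/-- `G` has a proper edge coloring with `k` colors. The coloring is encoded as a symmetric function
on all pairs of vertices, whose values matter on adjacent pairs only. -/
def EdgeColorable {V : Type*} (G : SimpleGraph V) (k : ℕ) : Prop :=
  ∃ c : V → V → Fin k, (∀ u v, c u v = c v u) ∧
    ∀ u v w, G.Adj u v → G.Adj u w → v ≠ w → c u v ≠ c u w

theorem chromaticIndex_le_iff {V : Type u} {G : SimpleGraph V} {k : ℕ} (hk : 0 < k) :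
    chromaticIndex G ≤ k ↔ EdgeColorable G k := by
  rw [chromaticIndex, chromaticNumber_le_iff_colorable]
  constructor
  · rintro ⟨C⟩
    have hval : ∀ e f (he : e ∈ G.edgeSet) (hf : f ∈ G.edgeSet) (x : V), x ∈ e → x ∈ f → e ≠ f →
        C ⟨e, he⟩ ≠ C ⟨f, hf⟩ := fun e f he hf x hxe hxf hne ↦
      C.valid (lineGraph_adj_iff_exists.2 ⟨fun h ↦ hne (congrArg Subtype.val h), x, hxe, hxf⟩)
    refine ⟨fun u v ↦ if h : s(u, v) ∈ G.edgeSet then C ⟨s(u, v), h⟩ else ⟨0, hk⟩, ?_, ?_⟩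
    · intro u v
      simp only [Sym2.eq_swap (a := u) (b := v)]
    · intro u v w huv huw hvw
      have h1 : s(u, v) ∈ G.edgeSet := huv
      have h2 : s(u, w) ∈ G.edgeSet := huw
      simp only [dif_pos h1, dif_pos h2]
      refine hval _ _ h1 h2 u (by simp) (by simp) fun h ↦ hvw (Sym2.congr_right.1 h)
  · rintro ⟨c, hs, hc⟩
    refine ⟨Coloring.mk (fun e ↦ Sym2.lift ⟨c, hs⟩ e.1) ?_⟩
    rintro ⟨e, he⟩ ⟨f, hf⟩ hef
    obtain ⟨hne, x, hxe, hxf⟩ := lineGraph_adj_iff_exists.1 hef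
    obtain ⟨y, rfl⟩ := hxe
    obtain ⟨z, rfl⟩ := hxf
    exact hc x y z he hf fun h ↦ hne (by subst h; rfl)

/-- Recoloring a deleted edge with an additional color. -/
theorem EdgeColorable.of_deleteEdges {V : Type*} {G : SimpleGraph V} {n : ℕ} {e : Sym2 V}
    (h : EdgeColorable (G.deleteEdges {e}) n) : EdgeColorable G (n + 1) := by
  obtain ⟨c, hs, hc⟩ := h
  refine ⟨fun u v ↦ if s(u, v) = e then Fin.last n else (c u v).castSucc, ?_, ?_⟩
  · intro u v
    simp only [Sym2.eq_swap (a := u) (b := v), hs u v]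
  · intro u v w huv huw hvw
    have hne : s(u, v) ≠ s(u, w) := fun h ↦ hvw (Sym2.congr_right.1 h)
    dsimp only
    split_ifs with h1 h2 h2
    · exact absurd (h1.trans h2.symm) hne
    · exact (Fin.castSucc_lt_last _).ne'
    · exact (Fin.castSucc_lt_last _).ne
    · exact fun h ↦ hc u v w (by simp [huv, h1]) (by simp [huw, h2]) hvw
        (Fin.castSucc_injective _ h)

theorem exists_deleteEdges_edgeColorable {V : Type u} {G : SimpleGraph V} {k : ℕ} [Fintype V]
    (h : IsCritical G k) {e : Sym2 V} (he : e ∈ G.edgeSet) :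
    EdgeColorable (G.deleteEdges {e}) k :=
  (chromaticIndex_le_iff (by have := h.1; omega)).1 (h.2.2.2.2 e he).le

/-- In the definition of criticality the exact chromatic indices may be replaced by
non-`k`-colorability of `G` and `k`-colorability of each `G - e`: coloring one edge separately
costs a single color, so no appeal to Vizing's theorem is needed. -/
theorem isCritical_iff {V : Type u} [Fintype V] {G : SimpleGraph V} {k : ℕ} :
    IsCritical G k ↔ 2 ≤ k ∧ (∀ v, ∃ w, G.Adj v w) ∧ G.maxDegree = k ∧ ¬ EdgeColorable G k ∧
      ∀ e ∈ G.edgeSet, EdgeColorable (G.deleteEdges {e}) k := by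
  constructor
  · intro h
    refine ⟨h.1, h.2.1, h.2.2.1, ?_, fun e he ↦ exists_deleteEdges_edgeColorable h he⟩
    rw [← chromaticIndex_le_iff (by have := h.1; omega), h.2.2.2.1]
    exact_mod_cast Nat.not_succ_le_self k
  · rintro ⟨hk, hiso, hmax, hnot, hdel⟩
    refine ⟨hk, hiso, hmax, ?_, ?_⟩
    · obtain ⟨v, w, hvw⟩ : ∃ v w, G.Adj v w := by
        have : Nonempty V := by
          by_contra hV
          rw [not_nonempty_iff] at hV
          simp at hmax
          omega
        exact ⟨_, hiso this.some⟩
      apply le_antisymm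
      · exact_mod_cast (chromaticIndex_le_iff (k := k + 1) (by omega)).2
          (hdel s(v, w) hvw).of_deleteEdges
      · rw [← chromaticIndex_le_iff (by omega), not_le] at hnot
        exact Order.add_one_le_of_lt hnot
    · intro e he
      apply le_antisymm ((chromaticIndex_le_iff (by omega)).2 (hdel e he))
      by_contra hlt
      obtain ⟨n, rfl⟩ : ∃ n, k = n + 1 := ⟨k - 1, by omega⟩
      rw [not_le, Nat.cast_add, Nat.cast_one, ENat.lt_add_one_iff (ENat.natCast_ne_top n),
        chromaticIndex_le_iff (by omega)] at hlt
      exact hnot hlt.of_deleteEdges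

/-- If `G - vw` is properly colored with `k` colors but `G` is not `k`-edge-colorable, a color
missing at `w` occurs at `v`. -/
theorem exists_color_eq_of_missing {V : Type*} {G : SimpleGraph V} {k : ℕ} {v w : V}
    (hnot : ¬ EdgeColorable G k) {c : V → V → Fin k} (hs : ∀ u v, c u v = c v u)
    (hc : ∀ u x y, (G.deleteEdges {s(v, w)}).Adj u x → (G.deleteEdges {s(v, w)}).Adj u y →
      x ≠ y → c u x ≠ c u y)
    {b : Fin k} (hb : ∀ u, (G.deleteEdges {s(v, w)}).Adj w u → c w u ≠ b) :
    ∃ u, (G.deleteEdges {s(v, w)}).Adj v u ∧ c v u = b := by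
  by_contra! hv
  refine hnot ⟨fun x y ↦ if s(x, y) = s(v, w) then b else c x y, ?_, ?_⟩
  · intro x y
    simp only [Sym2.eq_swap (a := x) (b := y), hs x y]
  have key : ∀ x y z, G.Adj x z → s(x, y) = s(v, w) → s(x, z) ≠ s(v, w) → c x z ≠ b := by
    intro x y z hz hy hz'
    have hadj : (G.deleteEdges {s(v, w)}).Adj x z := by simp [hz, hz']
    rcases Sym2.eq_iff.1 hy with ⟨rfl, rfl⟩ | ⟨rfl, rfl⟩
    · exact hv z hadj
    · exact hb z hadj
  intro x y z hy hz hyz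
  have hne : s(x, y) ≠ s(x, z) := fun h ↦ hyz (Sym2.congr_right.1 h)
  dsimp only
  split_ifs with h1 h2 h2
  · exact absurd (h1.trans h2.symm) hne
  · exact (key x y z hz h1 h2).symm
  · exact key x z y hy h2 h1
  · exact hc x y z (by simp [hy, h1]) (by simp [hz, h2]) hyz

theorem exists_missing_color {V : Type*} [Fintype V] {G : SimpleGraph V} {k : ℕ} {v w : V}
    (hvw : G.Adj v w) (hdeg : G.degree w ≤ k) (c : V → V → Fin k) :
    ∃ b, ∀ u, (G.deleteEdges {s(v, w)}).Adj w u → c w u ≠ b := by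
  have hcard : (((G.neighborFinset w).erase v).image (c w)).card <
      (Finset.univ : Finset (Fin k)).card := by
    refine Finset.card_image_le.trans_lt ?_
    rw [Finset.card_erase_of_mem (by simpa using hvw.symm), card_neighborFinset_eq_degree,
      Finset.card_univ, Fintype.card_fin]
    have : 0 < G.degree w := by
      rw [← card_neighborFinset_eq_degree, Finset.card_pos]
      exact ⟨v, by simpa using hvw.symm⟩
    omega
  obtain ⟨b, -, hb⟩ := Finset.exists_mem_notMem_of_card_lt_card hcard
  refine ⟨b, fun u hu hub ↦ hb (Finset.mem_image.2 ⟨u, ?_, hub⟩)⟩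
  rw [deleteEdges_adj] at hu
  refine Finset.mem_erase.2 ⟨?_, by simpa using hu.1⟩
  rintro rfl
  exact hu.2 (by simp [Sym2.eq_swap])

/-! ### Latin rectangles -/

/-- A cyclic Latin rectangle with `k` rows and `k - 1` columns, conjugated by a permutation `τ`,
in which the row `s` avoids the color `s`. -/
theorem exists_latin_rectangle {m : ℕ} (τ : Equiv.Perm (Fin (m + 2))) (y : Fin (m + 1)) :
    ∃ L : Fin (m + 2) → Fin (m + 1) → Fin (m + 2), (∀ s j, L s j ≠ s) ∧
      (∀ j, Function.Injective fun s ↦ L s j) ∧ (∀ s, Function.Injective (L s)) ∧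
      ∀ s, L s y = τ.symm (τ s + 1) := by
  refine ⟨fun s j ↦ τ.symm (τ s + (Equiv.swap y 0 j).succ), ?_, ?_, ?_, ?_⟩
  · intro s j h
    rw [Equiv.symm_apply_eq, add_eq_left] at h
    exact Fin.succ_ne_zero _ h
  · intro j s s' h
    simpa using h
  · intro s j j' h
    simpa using h
  · intro s
    simp

/-- The coloring of the complete bipartite graph between `Fin k` and `Fin (k - 1)`, minus the
edge `xy`, in which the left vertex `s` misses the color `s`, except that the vertex `x₁` misses
the color `b ≠ x₁`. Hence `b` is missing at both `b` and `x₁`.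

If `x = x₁`, delete an edge of color `b` at `x₁` from a proper coloring. If not, start from
a coloring in which `x₁y` and `xy` have the colors `b` and `x₁`, delete `xy`, and
recolor `x₁y` with `x₁`. -/
theorem exists_defect_rectangle {k : ℕ} {x₁ x b : Fin k} (hb : b ≠ x₁) (hx : b ≠ x)
    (y : Fin (k - 1)) :
    ∃ B : Fin k → Fin (k - 1) → Fin k,
      (∀ j s s', s ≠ s' → (s, j) ≠ (x, y) → (s', j) ≠ (x, y) → B s j ≠ B s' j) ∧
      (∀ s j j', j ≠ j' → (s, j) ≠ (x, y) → (s, j') ≠ (x, y) → B s j ≠ B s j') ∧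
      ∀ s j, (s, j) ≠ (x, y) → B s j ≠ if s = x₁ then b else s := by
  obtain ⟨m, rfl⟩ : ∃ m, k = m + 2 := ⟨k - 2, by have := y.2; omega⟩
  change Fin (m + 1) at y
  change ∃ B : Fin (m + 2) → Fin (m + 1) → Fin (m + 2), _
  rcases eq_or_ne x x₁ with rfl | hxx
  -- The column `y` of the rectangle is the cyclic successor transported by `τ`, so it maps `x` to `b`.
  · obtain ⟨τ, hτ⟩ := Equiv.Perm.exists_extending_pair ![x, b] ![(0 : Fin (m + 2)), 1]
      (by intro i j; fin_cases i <;> fin_cases j <;> simp [hb, hb.symm])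
      (by intro i j; fin_cases i <;> fin_cases j <;> simp)
    have h0 : τ x = 0 := hτ 0
    have h1 : τ b = 1 := hτ 1
    obtain ⟨L, hL1, hL2, hL3, hL4⟩ := exists_latin_rectangle τ y
    have hxy : L x y = b := by rw [hL4, h0, zero_add, ← h1, Equiv.symm_apply_apply]
    refine ⟨L, fun j s s' hs _ _ h ↦ hs (hL2 j h), fun s j j' hj _ _ h ↦ hj (hL3 s h), ?_⟩
    intro s j hne
    split_ifs with h
    · subst h
      rw [← hxy]
      exact fun h ↦ hne (by rw [hL3 _ h])
    · exact hL1 s j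
  -- Here the column `y` maps `x` to `x₁` and `x₁` to `b`.
  · obtain ⟨τ, hτ⟩ := Equiv.Perm.exists_extending_pair ![x, x₁, b] ![(0 : Fin (m + 2)), 1, 1 + 1]
      (by intro i j
          fin_cases i <;> fin_cases j <;> simp [hb, hb.symm, hx, hx.symm, hxx, hxx.symm])
      (by
        have h3 : 3 ≤ m + 2 := by
          have := Finset.card_le_univ ({x, x₁, b} : Finset (Fin (m + 2)))
          rwa [Finset.card_eq_three.2 ⟨x, x₁, b, hxx, hx.symm, hb.symm, rfl⟩, Fintype.card_fin]
            at this
        obtain ⟨n, rfl⟩ : ∃ n, m = n + 1 := ⟨m - 1, by omega⟩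
        have h2 : 2 % (n + 1 + 2) = 2 := Nat.mod_eq_of_lt (by omega)
        intro i j
        fin_cases i <;> fin_cases j <;> simp [Fin.ext_iff, Fin.val_add, h2])
    have h0 : τ x = 0 := hτ 0
    have h1 : τ x₁ = 1 := hτ 1
    have h2 : τ b = 1 + 1 := hτ 2
    obtain ⟨L, hL1, hL2, hL3, hL4⟩ := exists_latin_rectangle τ y
    have hxy : L x y = x₁ := by rw [hL4, h0, zero_add, ← h1, Equiv.symm_apply_apply]
    have hx₁y : L x₁ y = b := by rw [hL4, h1, ← h2, Equiv.symm_apply_apply]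
    refine ⟨fun s j ↦ if s = x₁ ∧ j = y then x₁ else L s j, ?_, ?_, ?_⟩
    · intro j s s' hs hne hne'
      have hcol : ∀ s, (s, j) ≠ (x, y) → j = y → L s j ≠ x₁ := by
        rintro s h rfl h'
        exact h (by rw [hL2 j (h'.trans hxy.symm)])
      dsimp only
      split_ifs with h h' h'
      · exact absurd (h.1.trans h'.1.symm) hs
      · exact (hcol s' hne' h.2).symm
      · exact hcol s hne h'.2
      · exact fun h ↦ hs (hL2 j h)
    · intro s j j' hj hne hne'
      dsimp only
      split_ifs with h h' h'
      · exact absurd (h.2.trans h'.2.symm) hj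
      · rw [h.1]; exact (hL1 _ _).symm
      · rw [h'.1]; exact hL1 _ _
      · exact fun h ↦ hj (hL3 s h)
    · intro s j hne
      dsimp only
      split_ifs with h h' h'
      · exact hb.symm
      · exact absurd h.1 h'
      · subst h'
        rw [← hx₁y]
        exact fun h'' ↦ h ⟨rfl, hL3 _ h''⟩
      · exact hL1 s j

/-! ### Meredith extensions -/

variable {V : Type u} {k : ℕ}

/-- A numbering of the edges at each vertex by elements of `Fin k`: the edge `vw` uses the
port `p v w` of `v`, and different edges at `v` use different ports. Values on non-adjacent pairs
are irrelevant. -/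
def IsPortMap (G : SimpleGraph V) (p : V → V → Fin k) : Prop :=
  ∀ v w w', G.Adj v w → G.Adj v w' → p v w = p v w' → w = w'

theorem exists_isPortMap [Fintype V] {G : SimpleGraph V} (hk : 0 < k)
    (hG : ∀ v, G.degree v ≤ k) : ∃ p : V → V → Fin k, IsPortMap G p := by
  have h : ∀ v, ∃ q : V → Fin k, Set.InjOn q (G.neighborFinset v) := by
    intro v
    have : Nonempty (Fin k) := ⟨⟨0, hk⟩⟩
    obtain ⟨f⟩ : Nonempty (G.neighborFinset v ↪ Fin k) :=
      Function.Embedding.nonempty_of_card_le (by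
        rw [Fintype.card_coe, card_neighborFinset_eq_degree, Fintype.card_fin]; exact hG v)
    refine ⟨fun w ↦ if h : w ∈ G.neighborFinset v then f ⟨w, h⟩ else ⟨0, hk⟩, ?_⟩
    intro w hw w' hw' hww
    rw [Finset.mem_coe] at hw hw'
    simp only [dif_pos hw, dif_pos hw'] at hww
    exact congrArg Subtype.val (f.injective hww)
  choose q hq using h
  exact ⟨q, fun v w w' hw hw' h ↦ hq v (by simpa using hw) (by simpa using hw') h⟩

/-- The adjacency relation of the Meredith extension. -/
def MeredithAdj (G : SimpleGraph V) (p : V → V → Fin k) :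
    V × (Fin k ⊕ Fin (k - 1)) → V × (Fin k ⊕ Fin (k - 1)) → Prop
  | (v, .inl a), (w, .inl b) => G.Adj v w ∧ p v w = a ∧ p w v = b
  | (v, .inl _), (w, .inr _) => v = w
  | (v, .inr _), (w, .inl _) => v = w
  | (_, .inr _), (_, .inr _) => False

/-- The Meredith extension of `G` at all vertices: each vertex `v` is replaced by a block, a
complete bipartite graph with sides `Fin k` and `Fin (k - 1)`, and each edge `vw` of `G` by the
edge joining the vertex `p v w` on the larger side of the block of `v` to the vertex `p w v` on
the larger side of the block of `w`. -/
def meredith (G : SimpleGraph V) (p : V → V → Fin k) :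
    SimpleGraph (V × (Fin k ⊕ Fin (k - 1))) where
  Adj := MeredithAdj G p
  symm := ⟨by
    rintro ⟨v, a | a⟩ ⟨w, b | b⟩ h
    · exact ⟨h.1.symm, h.2.2, h.2.1⟩
    · exact Eq.symm h
    · exact Eq.symm h
    · exact h⟩
  loopless := ⟨by
    rintro ⟨v, a | a⟩ h
    · exact G.loopless.irrefl v h.1
    · exact h⟩

variable {G : SimpleGraph V} {p : V → V → Fin k}

@[simp] theorem meredith_inl_inl {v w : V} {a b : Fin k} :
    (meredith G p).Adj (v, .inl a) (w, .inl b) ↔ G.Adj v w ∧ p v w = a ∧ p w v = b := Iff.rfl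

@[simp] theorem meredith_inl_inr {v w : V} {a : Fin k} {j : Fin (k - 1)} :
    (meredith G p).Adj (v, .inl a) (w, .inr j) ↔ v = w := Iff.rfl

@[simp] theorem meredith_inr_inl {v w : V} {a : Fin k} {j : Fin (k - 1)} :
    (meredith G p).Adj (v, .inr j) (w, .inl a) ↔ v = w := Iff.rfl

@[simp] theorem meredith_inr_inr {v w : V} {i j : Fin (k - 1)} :
    ¬ (meredith G p).Adj (v, .inr i) (w, .inr j) := fun h ↦ h

/-- A color repeated at two edges of `G` at `v` would be used at most `k - 2` times inside the
block of `v`, but each of the `k - 1` vertices of degree `k` on the smaller side sees it. -/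
theorem EdgeColorable.of_meredith (hp : IsPortMap G p) (h : EdgeColorable (meredith G p) k) :
    EdgeColorable G k := by
  obtain ⟨C, hs, hC⟩ := h
  refine ⟨fun v w ↦ C (v, .inl (p v w)) (w, .inl (p w v)), fun _ _ ↦ hs _ _, ?_⟩
  intro v w₁ w₂ h₁ h₂ hne heq
  set s := C (v, .inl (p v w₁)) (w₁, .inl (p w₁ v)) with hsdef
  have hports : p v w₁ ≠ p v w₂ := fun h ↦ hne (hp _ _ _ h₁ h₂ h)
  have hsurj : ∀ j : Fin (k - 1), ∃ a : Fin k, C (v, .inr j) (v, .inl a) = s := by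
    intro j
    refine (Finite.injective_iff_surjective (f := fun a ↦ C (v, .inr j) (v, .inl a))).1 ?_ s
    intro a a' haa
    by_contra hne'
    exact hC _ _ _ (by simp) (by simp) (by simpa using hne') haa
  choose g hg using hsurj
  have hginj : Function.Injective g := by
    intro j j' hjj
    by_contra hne'
    refine hC (v, .inl (g j)) (v, .inr j) (v, .inr j') (by simp) (by simp) (by simpa using hne') ?_
    rw [hs, hg, hs, hjj, hg]
  have havoid : ∀ w, G.Adj v w → C (v, .inl (p v w)) (w, .inl (p w v)) = s → ∀ j, g j ≠ p v w := by
    intro w hw hws j hj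
    refine hC (v, .inl (p v w)) (w, .inl (p w v)) (v, .inr j) (by simp [hw]) (by simp) (by simp) ?_
    rw [hws, hs, ← hj, hg]
  have hsub : Finset.univ.image g ⊆ (Finset.univ.erase (p v w₁)).erase (p v w₂) := by
    intro a ha
    obtain ⟨j, -, rfl⟩ := Finset.mem_image.1 ha
    simp [havoid w₁ h₁ rfl j, havoid w₂ h₂ heq.symm j]
  have hcard := Finset.card_le_card hsub
  rw [Finset.card_image_of_injective _ hginj, Finset.card_erase_of_mem (by simpa using hports.symm),
    Finset.card_erase_of_mem (by simp)] at hcard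
  simp only [Finset.card_univ, Fintype.card_fin] at hcard
  have h1 := (p v w₁).2
  have h2 := (p v w₂).2
  have h3 := fun h ↦ hports (Fin.ext h)
  omega

/-- A coloring of a subgraph of a Meredith extension, assembled from a coloring `c` of the edges
between blocks and colorings `B v` of the blocks. -/
theorem edgeColorable_of_le_meredith (hp : IsPortMap G p)
    {H : SimpleGraph (V × (Fin k ⊕ Fin (k - 1)))} (hH : H ≤ meredith G p)
    (c : V → V → Fin k) (hs : ∀ v w, c v w = c w v) (B : V → Fin k → Fin (k - 1) → Fin k)
    (hcol : ∀ v j a a', H.Adj (v, .inl a) (v, .inr j) → H.Adj (v, .inl a') (v, .inr j) →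
      a ≠ a' → B v a j ≠ B v a' j)
    (hrow : ∀ v a j j', H.Adj (v, .inl a) (v, .inr j) → H.Adj (v, .inl a) (v, .inr j') →
      j ≠ j' → B v a j ≠ B v a j')
    (hport : ∀ v w j, H.Adj (v, .inl (p v w)) (w, .inl (p w v)) →
      H.Adj (v, .inl (p v w)) (v, .inr j) → c v w ≠ B v (p v w) j) :
    EdgeColorable H k := by
  let C : V × (Fin k ⊕ Fin (k - 1)) → V × (Fin k ⊕ Fin (k - 1)) → Fin k
    | (v, .inl _), (w, .inl _) => c v w
    | (v, .inl a), (_, .inr j) => B v a j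
    | (_, .inr j), (w, .inl a) => B w a j
    | (v, .inr _), (w, .inr _) => c v w
  refine ⟨C, ?_, ?_⟩
  · rintro ⟨v, a | a⟩ ⟨w, b | b⟩
    · exact hs v w
    · rfl
    · rfl
    · exact hs v w
  · rintro ⟨u, a | a⟩ ⟨v, b | b⟩ ⟨w, d | d⟩ huv huw hvw
    · obtain ⟨h1, rfl, rfl⟩ := hH huv
      obtain ⟨h2, h3, rfl⟩ := hH huw
      obtain rfl := hp _ _ _ h2 h1 h3
      exact absurd rfl hvw
    · obtain ⟨h1, rfl, rfl⟩ := hH huv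
      obtain rfl : u = w := hH huw
      exact hport u v d huv huw
    · obtain ⟨h1, rfl, rfl⟩ := hH huw
      obtain rfl : u = v := hH huv
      exact (hport u w b huw huv).symm
    · obtain rfl : u = w := hH huw
      obtain rfl : u = v := hH huv
      exact hrow u a b d huv huw fun h ↦ hvw (by rw [h])
    · obtain rfl : u = w := hH huw
      obtain rfl : u = v := hH huv
      exact hcol u a b d huv.symm huw.symm fun h ↦ hvw (by rw [h])
    · exact (meredith_inr_inr (hH huw)).elim
    · exact (meredith_inr_inr (hH huv)).elim
    · exact (meredith_inr_inr (hH huv)).elim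

/-- Any proper coloring of edges at `v` is induced by a bijection from ports to colors. -/
theorem exists_perm_port (hp : IsPortMap G p) {v : V} {c : V → Fin k} {N : Set V}
    (hN : ∀ w ∈ N, G.Adj v w) (hc : Set.InjOn c N) :
    ∃ σ : Equiv.Perm (Fin k), ∀ w ∈ N, σ (p v w) = c w := by
  have : Finite N := Finite.of_injective _ hc.injective
  obtain ⟨σ, hσ⟩ := Equiv.Perm.exists_extending_pair (fun w : N ↦ p v w) (fun w : N ↦ c w)
    (fun w w' h ↦ Subtype.ext (hp _ _ _ (hN _ w.2) (hN _ w'.2) h)) hc.injective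
  exact ⟨σ, fun w hw ↦ hσ ⟨w, hw⟩⟩

/-- Deleting an edge between two blocks: every block is colored by a Latin rectangle. -/
theorem edgeColorable_meredith_deleteEdges_inl (hk : 2 ≤ k) (hp : IsPortMap G p) {v w : V}
    (h : EdgeColorable (G.deleteEdges {s(v, w)}) k) :
    EdgeColorable ((meredith G p).deleteEdges {s((v, .inl (p v w)), (w, .inl (p w v)))}) k := by
  obtain ⟨m, rfl⟩ : ∃ m, k = m + 2 := ⟨k - 2, by omega⟩
  obtain ⟨c, hs, hc⟩ := h
  have hσ : ∀ u, ∃ σ : Equiv.Perm (Fin (m + 2)),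
      ∀ x ∈ {x | (G.deleteEdges {s(v, w)}).Adj u x}, σ (p u x) = c u x := fun u ↦
    exists_perm_port hp (fun x hx ↦ (deleteEdges_le _) hx)
      fun x hx y hy hxy ↦ by_contra fun hne ↦ hc u x y hx hy hne hxy
  choose σ hσ using hσ
  obtain ⟨L, hL1, hL2, hL3, -⟩ := exists_latin_rectangle (m := m) 1 0
  refine edgeColorable_of_le_meredith hp (deleteEdges_le _) c hs (fun u a ↦ L (σ u a)) ?_ ?_ ?_
  · intro u j a a' _ _ hne h
    exact hne ((σ u).injective (hL2 j h))
  · intro u a j j' _ _ hne h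
    exact hne (hL3 _ h)
  · intro u x j hux _
    rw [deleteEdges_adj] at hux
    rw [← hσ u x]
    · exact (hL1 _ _).symm
    · rw [Set.mem_ofPred_eq, deleteEdges_adj]
      refine ⟨hux.1.1, fun h ↦ hux.2 ?_⟩
      rcases Sym2.eq_iff.1 h with ⟨rfl, rfl⟩ | ⟨rfl, rfl⟩
      · rfl
      · exact Sym2.eq_swap

/-- Deleting an edge `xy` inside the block of `v`. Start from a coloring of `G - vw`, where `w` is
the neighbor at the port `x` if there is one, and give `vw` a color `b` missing at `w`. Then `b` is
repeated at `v`, and the defect that this requires in the block of `v` can be moved to `xy`. -/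
theorem edgeColorable_meredith_deleteEdges_inr [Fintype V] (hp : IsPortMap G p)
    (hdeg : ∀ v, G.degree v ≤ k) (hiso : ∀ v, ∃ w, G.Adj v w) (hnot : ¬ EdgeColorable G k)
    (hdel : ∀ e ∈ G.edgeSet, EdgeColorable (G.deleteEdges {e}) k)
    (v : V) (x : Fin k) (y : Fin (k - 1)) :
    EdgeColorable ((meredith G p).deleteEdges {s((v, .inl x), (v, .inr y))}) k := by
  obtain ⟨w, hvw, hwx⟩ : ∃ w, G.Adj v w ∧ ∀ u, G.Adj v u → p v u = x → u = w := by
    by_cases h : ∃ w, G.Adj v w ∧ p v w = x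
    · obtain ⟨w, hw, rfl⟩ := h
      exact ⟨w, hw, fun u hu huw ↦ hp _ _ _ hu hw huw⟩
    · obtain ⟨w, hw⟩ := hiso v
      exact ⟨w, hw, fun u hu hux ↦ (h ⟨u, hu, hux⟩).elim⟩
  obtain ⟨c, hs, hc⟩ := hdel s(v, w) hvw
  obtain ⟨b, hb⟩ := exists_missing_color hvw (hdeg w) c
  obtain ⟨w₂, hw₂, hbw₂⟩ := exists_color_eq_of_missing hnot hs hc hb
  have hvadj : ∀ z, (G.deleteEdges {s(v, w)}).Adj v z ↔ G.Adj v z ∧ z ≠ w := by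
    intro z
    rw [deleteEdges_adj, Set.mem_singleton_iff, Sym2.congr_right]
  rw [hvadj] at hw₂
  let ext : V → V → Fin k := fun u z ↦ if s(u, z) = s(v, w) then b else c u z
  have hext : ∀ u z, ext u z = ext z u := by
    intro u z
    simp only [ext, Sym2.eq_swap (a := u) (b := z), hs u z]
  have hextw : ext v w = b := if_pos rfl
  have hextv : ∀ z, z ≠ w → ext v z = c v z := fun z hz ↦
    if_neg fun h ↦ hz (Sym2.congr_right.1 h)
  have hinj : ∀ u, u ≠ v → Set.InjOn (ext u) {z | G.Adj u z} := by
    intro u huv z hz z' hz' hzz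
    by_contra hne
    have key : ∀ z z', G.Adj u z → s(u, z) ≠ s(v, w) → s(u, z') = s(v, w) → c u z ≠ b := by
      intro z z' hz h h'
      rcases Sym2.eq_iff.1 h' with ⟨rfl, rfl⟩ | ⟨rfl, rfl⟩
      · exact absurd rfl huv
      · exact hb z (by rw [deleteEdges_adj]; exact ⟨hz, h⟩)
    simp only [ext] at hzz
    split_ifs at hzz with h h' h'
    · exact hne (Sym2.congr_right.1 (h.trans h'.symm))
    · exact key z' z hz' h' h hzz.symm
    · exact key z z' hz h h' hzz
    · exact hc u z z' (by rw [deleteEdges_adj]; exact ⟨hz, h⟩)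
        (by rw [deleteEdges_adj]; exact ⟨hz', h'⟩) hne hzz
  have hσ : ∀ u, u ≠ v → ∃ σ : Equiv.Perm (Fin k), ∀ z ∈ {z | G.Adj u z}, σ (p u z) = ext u z :=
    fun u hu ↦ exists_perm_port hp (fun z hz ↦ hz) (hinj u hu)
  choose! σ hσ using hσ
  -- At `v` the recolored edge `vw` is left out: its color `b` is already that of `v w₂`.
  obtain ⟨ρ, hρ⟩ := exists_perm_port (c := c v) (v := v) (N := {z | G.Adj v z ∧ z ≠ w}) hp
    (fun z hz ↦ hz.1) fun z hz z' hz' hzz ↦ by_contra fun hne ↦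
      hc v z z' ((hvadj z).2 hz) ((hvadj z').2 hz') hne hzz
  have hρb : ρ (p v w₂) = b := (hρ w₂ hw₂).trans hbw₂
  obtain ⟨B, hB1, hB2, hB3⟩ := exists_defect_rectangle (x₁ := ρ (p v w)) (x := ρ x) (b := b)
    (fun h ↦ hw₂.2 (hp _ _ _ hw₂.1 hvw (ρ.injective (hρb.trans h))))
    (fun h ↦ hw₂.2 (hwx w₂ hw₂.1 (ρ.injective (hρb.trans h)))) y
  obtain ⟨m, rfl⟩ : ∃ m, k = m + 2 := ⟨k - 2, by have := y.2; omega⟩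
  obtain ⟨L, hL1, hL2, hL3, -⟩ := exists_latin_rectangle (m := m) 1 0
  have hne : ∀ a j, ((meredith G p).deleteEdges {s((v, .inl x), (v, .inr y))}).Adj
      (v, .inl a) (v, .inr j) → (ρ a, j) ≠ (ρ x, y) := by
    intro a j h h'
    rw [deleteEdges_adj] at h
    rw [Prod.mk.injEq, ρ.injective.eq_iff] at h'
    exact h.2 (by rw [h'.1, h'.2]; rfl)
  refine edgeColorable_of_le_meredith hp (deleteEdges_le _) ext hext
    (fun u a ↦ if u = v then B (ρ a) else L (σ u a)) ?_ ?_ ?_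
  · intro u j a a' ha ha' haa
    split_ifs with huv
    · subst huv
      exact hB1 j _ _ (ρ.injective.ne haa) (hne a j ha) (hne a' j ha')
    · exact fun h ↦ haa ((σ u).injective (hL2 j h))
  · intro u a j j' ha ha' hjj
    split_ifs with huv
    · subst huv
      exact hB2 _ j j' hjj (hne a j ha) (hne a j' ha')
    · exact fun h ↦ hjj (hL3 _ h)
  · intro u z j huz ha
    have hz : G.Adj u z := (deleteEdges_le _ huz).1
    split_ifs with huv
    · subst huv
      have h3 := (hB3 _ j (hne _ j ha)).symm
      by_cases hzw : z = w
      · subst hzw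
        rwa [if_pos rfl, ← hextw] at h3
      · rw [if_neg fun h ↦ hzw (hp _ _ _ hz hvw (ρ.injective h)), hρ z ⟨hz, hzw⟩,
          ← hextv z hzw] at h3
        rwa [hρ z ⟨hz, hzw⟩, ← hextv z hzw]
    · rw [← hσ u huv z hz]
      exact (hL1 _ _).symm

/-! ### Degrees in a Meredith extension -/

variable [Fintype V]

theorem degree_meredith_inr (v : V) (j : Fin (k - 1)) : (meredith G p).degree (v, .inr j) = k := by
  have : (meredith G p).neighborFinset (v, .inr j) =
      Finset.univ.image fun a : Fin k ↦ ((v, .inl a) : V × (Fin k ⊕ Fin (k - 1))) := by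
    ext ⟨w, a | a⟩ <;> simp
  rw [← card_neighborFinset_eq_degree, this, Finset.card_image_of_injective, Finset.card_univ,
    Fintype.card_fin]
  intro a b
  simp

theorem degree_meredith_inl_of_adj (hk : 0 < k) (hp : IsPortMap G p) {v w : V} (h : G.Adj v w) :
    (meredith G p).degree (v, .inl (p v w)) = k := by
  have : (meredith G p).neighborFinset (v, .inl (p v w)) = insert (w, .inl (p w v))
      (Finset.univ.image fun j : Fin (k - 1) ↦ ((v, .inr j) : V × (Fin k ⊕ Fin (k - 1)))) := by
    ext ⟨u, a | a⟩
    · simp only [mem_neighborFinset, meredith_inl_inl, Finset.mem_insert, Prod.mk.injEq,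
        Sum.inl.injEq, Finset.mem_image, reduceCtorEq, and_false, exists_false, or_false]
      constructor
      · rintro ⟨h1, h2, rfl⟩
        obtain rfl := hp _ _ _ h1 h h2
        exact ⟨rfl, rfl⟩
      · rintro ⟨rfl, rfl⟩
        exact ⟨h, rfl, rfl⟩
    · simp
  rw [← card_neighborFinset_eq_degree, this, Finset.card_insert_of_notMem (by simp),
    Finset.card_image_of_injective, Finset.card_univ, Fintype.card_fin]
  · omega
  · intro a b
    simp

theorem degree_meredith_inl_of_not {v : V} {a : Fin k} (h : ¬ ∃ w, G.Adj v w ∧ p v w = a) :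
    (meredith G p).degree (v, .inl a) = k - 1 := by
  have : (meredith G p).neighborFinset (v, .inl a) =
      Finset.univ.image fun j : Fin (k - 1) ↦ ((v, .inr j) : V × (Fin k ⊕ Fin (k - 1))) := by
    ext ⟨u, b | b⟩
    · simp only [mem_neighborFinset, meredith_inl_inl, Finset.mem_image, Finset.mem_univ,
        Prod.mk.injEq, reduceCtorEq, and_false, exists_false, iff_false]
      exact fun h' ↦ h ⟨u, h'.1, h'.2.1⟩
    · simp
  rw [← card_neighborFinset_eq_degree, this, Finset.card_image_of_injective, Finset.card_univ,
    Fintype.card_fin]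
  intro a b
  simp

theorem degree_meredith (hk : 0 < k) (hp : IsPortMap G p) (x : V × (Fin k ⊕ Fin (k - 1))) :
    (meredith G p).degree x = k - 1 ∨ (meredith G p).degree x = k := by
  obtain ⟨v, a | j⟩ := x
  · by_cases h : ∃ w, G.Adj v w ∧ p v w = a
    · obtain ⟨w, hw, rfl⟩ := h
      exact .inr (degree_meredith_inl_of_adj hk hp hw)
    · exact .inl (degree_meredith_inl_of_not h)
  · exact .inr (degree_meredith_inr v j)

theorem mem_degreeClass_meredith (hk : 0 < k) (hp : IsPortMap G p)
    {x : V × (Fin k ⊕ Fin (k - 1))} :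
    x ∈ degreeClass (meredith G p) (k - 1) ↔
      ∃ a, x.2 = .inl a ∧ ¬ ∃ w, G.Adj x.1 w ∧ p x.1 w = a := by
  rw [degreeClass, Set.mem_ofPred_eq]
  constructor
  · intro h
    obtain ⟨v, a | j⟩ := x
    · refine ⟨a, rfl, ?_⟩
      dsimp only
      rintro ⟨w, hw, rfl⟩
      rw [degree_meredith_inl_of_adj hk hp hw] at h
      omega
    · rw [degree_meredith_inr] at h
      omega
  · rintro ⟨a, h1, h2⟩
    obtain ⟨v, b⟩ := x
    obtain rfl : b = .inl a := h1
    exact degree_meredith_inl_of_not h2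

theorem card_image_port (hp : IsPortMap G p) (v : V) :
    ((G.neighborFinset v).image (p v)).card = G.degree v := by
  rw [Finset.card_image_of_injOn, card_neighborFinset_eq_degree]
  intro w hw w' hw' h
  exact hp v w w' (by simpa using hw) (by simpa using hw') h

theorem degree_lt_of_free_port (hp : IsPortMap G p) {v : V} {a : Fin k}
    (ha : ¬ ∃ w, G.Adj v w ∧ p v w = a) : G.degree v < k := by
  rw [← card_image_port hp]
  refine (Finset.card_lt_univ_of_notMem (x := a) fun h ↦ ha ?_).trans_eq (Fintype.card_fin k)
  simpa using h

theorem free_port_unique (hp : IsPortMap G p) {v : V} (hv : k - 1 ≤ G.degree v) {a b : Fin k}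
    (ha : ¬ ∃ w, G.Adj v w ∧ p v w = a) (hb : ¬ ∃ w, G.Adj v w ∧ p v w = b) : a = b := by
  by_contra hab
  have hsub : (G.neighborFinset v).image (p v) ⊆ (Finset.univ.erase a).erase b := by
    intro d hd
    simp only [Finset.mem_image, mem_neighborFinset] at hd
    simp only [Finset.mem_erase, Finset.mem_univ, and_true]
    exact ⟨by rintro rfl; exact hb hd, by rintro rfl; exact ha hd⟩
  have hcard := Finset.card_le_card hsub
  rw [card_image_port hp, Finset.card_erase_of_mem (by simpa using Ne.symm hab),
    Finset.card_erase_of_mem (by simp), Finset.card_univ, Fintype.card_fin] at hcard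
  have h1 := a.2
  have h2 := b.2
  have h3 := fun h ↦ hab (Fin.ext h)
  omega

theorem IsCritical.nonempty (h : IsCritical G k) : Nonempty V := by
  by_contra hV
  rw [not_nonempty_iff] at hV
  have := h.2.2.1
  have := h.1
  simp at *
  omega

theorem IsCritical.degree_le (h : IsCritical G k) (v : V) : G.degree v ≤ k :=
  h.2.2.1 ▸ G.degree_le_maxDegree v

/-- Meredith extensions of `k`-critical graphs are `k`-critical. -/
theorem IsCritical.meredith (h : IsCritical G k) (hp : IsPortMap G p) :
    IsCritical (meredith G p) k := by
  obtain ⟨v⟩ := h.nonempty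
  have hdeg := h.degree_le
  obtain ⟨hk, hiso, -, hnot, hdel⟩ := isCritical_iff.1 h
  have hpos : 0 < k := by omega
  refine isCritical_iff.2 ⟨hk, ?_, ?_, fun h ↦ hnot (h.of_meredith hp), ?_⟩
  · rintro ⟨v, a | j⟩
    · exact ⟨(v, .inr ⟨0, by omega⟩), by simp⟩
    · exact ⟨(v, .inl ⟨0, by omega⟩), by simp⟩
  · apply le_antisymm
    · refine maxDegree_le_of_forall_degree_le _ _ fun x ↦ ?_
      rcases degree_meredith hpos hp x with h | h <;> omega
    · exact (degree_meredith_inr (G := G) (p := p) v ⟨0, by omega⟩).ge.trans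
        (degree_le_maxDegree _ _)
  · intro e
    induction e using Sym2.ind with
    | _ x y =>
      intro he
      rw [mem_edgeSet] at he
      obtain ⟨v, a | j⟩ := x <;> obtain ⟨w, b | i⟩ := y
      · obtain ⟨h1, rfl, rfl⟩ := he
        exact edgeColorable_meredith_deleteEdges_inl hk hp (hdel _ h1)
      · obtain rfl : v = w := he
        exact edgeColorable_meredith_deleteEdges_inr hp hdeg hiso hnot hdel v a i
      · obtain rfl : v = w := he
        rw [Sym2.eq_swap]
        exact edgeColorable_meredith_deleteEdges_inr hp hdeg hiso hnot hdel v b j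
      · exact (meredith_inr_inr he).elim

/-- An independent set of `G` with `α` elements yields one of the Meredith extension with
`(k - 1) |V(G)| + α` elements: take the larger side of the blocks of its elements and the
smaller side of all other blocks. -/
theorem le_indepNum_meredith (hk : 0 < k) :
    (k - 1) * Fintype.card V + G.indepNum ≤ (EdgeCritical.meredith G p).indepNum := by
  obtain ⟨I, hI⟩ := G.exists_isNIndepSet_indepNum
  let f : V → Finset (Fin k ⊕ Fin (k - 1)) := fun v ↦
    if v ∈ I then Finset.univ.image Sum.inl else Finset.univ.image Sum.inr
  let J : Finset (V × (Fin k ⊕ Fin (k - 1))) := Finset.univ.filter fun x ↦ x.2 ∈ f x.1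
  have hJl : ∀ v a, (v, Sum.inl a) ∈ J ↔ v ∈ I := by
    intro v a
    by_cases h : v ∈ I <;> simp [J, f, h]
  have hJr : ∀ v j, (v, Sum.inr j) ∈ J ↔ v ∉ I := by
    intro v a
    by_cases h : v ∈ I <;> simp [J, f, h]
  have hJ : (EdgeCritical.meredith G p).IsIndepSet J := by
    rintro ⟨v, a | a⟩ hv ⟨w, b | b⟩ hw hne hadj
    · rw [Finset.mem_coe, hJl] at hv hw
      exact hI.isIndepSet hv hw hadj.1.ne hadj.1
    · rw [Finset.mem_coe, hJl] at hv
      rw [Finset.mem_coe, hJr] at hw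
      obtain rfl : v = w := hadj
      exact hw hv
    · rw [Finset.mem_coe, hJr] at hv
      rw [Finset.mem_coe, hJl] at hw
      obtain rfl : v = w := hadj
      exact hv hw
    · exact meredith_inr_inr hadj
  refine le_trans (le_of_eq ?_) hJ.card_le_indepNum
  have hcard : J.card = ∑ v, (f v).card := by
    rw [← Finset.card_sigma]
    refine Finset.card_bij (fun x _ ↦ ⟨x.1, x.2⟩) ?_ ?_ ?_
    · intro x hx
      simpa [J] using hx
    · rintro ⟨v, a⟩ _ ⟨w, b⟩ _ h
      simpa using h
    · rintro ⟨v, a⟩ h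
      exact ⟨(v, a), by simpa [J] using h, rfl⟩
  have hf : ∀ v, (f v).card = (k - 1) + if v ∈ I then 1 else 0 := by
    intro v
    by_cases h : v ∈ I
    · simp only [f, if_pos h]
      rw [Finset.card_image_of_injective _ Sum.inl_injective, Finset.card_univ, Fintype.card_fin]
      omega
    · simp only [f, if_neg h]
      rw [Finset.card_image_of_injective _ Sum.inr_injective, Finset.card_univ, Fintype.card_fin]
      rfl
  rw [hcard, Finset.sum_congr rfl fun v _ ↦ hf v, Finset.sum_add_distrib, Finset.sum_const,
    Finset.card_univ, Finset.sum_boole, Finset.filter_univ_mem, hI.card_eq, smul_eq_mul, mul_comm]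
  simp

/-! ### Systems of disjoint paths -/

/-- From each vertex `v` of degree `k - 1` start `k - 1` paths with `m` edges, which pairwise share
at most their initial vertices and contain no further vertex of degree `k - 1`. The `j`-th
vertex of the `i`-th path at `v` is `f v i j`; only the values at vertices `v` of degree `k - 1`
and at `j ≤ m` matter. -/
def HasPathSystem (G : SimpleGraph V) (k m : ℕ) : Prop :=
  ∃ f : V → Fin (k - 1) → ℕ → V, ∀ v ∈ degreeClass G (k - 1),
    (∀ i, f v i 0 = v) ∧
    (∀ i, ∀ j < m, G.Adj (f v i j) (f v i (j + 1))) ∧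
    (∀ i, ∀ j ≤ m, j ≠ 0 → f v i j ∉ degreeClass G (k - 1)) ∧
    ∀ w ∈ degreeClass G (k - 1), ∀ i i', ∀ j ≤ m, ∀ j' ≤ m, f v i j = f w i' j' →
      v = w ∧ j = j' ∧ (j = 0 ∨ i = i')

theorem HasPathSystem.mono {m n : ℕ} (h : HasPathSystem G k n) (hmn : m ≤ n) :
    HasPathSystem G k m := by
  obtain ⟨f, hf⟩ := h
  refine ⟨f, fun v hv ↦ ?_⟩
  obtain ⟨h1, h2, h3, h4⟩ := hf v hv
  exact ⟨h1, fun i j hj ↦ h2 i j (by omega), fun i j hj ↦ h3 i j (by omega),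
    fun w hw i i' j hj j' hj' ↦ h4 w hw i i' j (by omega) j' (by omega)⟩

theorem exists_walk_support_eq {W : Type*} {H : SimpleGraph W} (g : ℕ → W) (m : ℕ)
    (hg : ∀ j < m, H.Adj (g j) (g (j + 1))) :
    ∃ q : H.Walk (g 0) (g m), q.support = (List.range (m + 1)).map g := by
  induction m with
  | zero => exact ⟨.nil, by simp⟩
  | succ m ih =>
    obtain ⟨q, hq⟩ := ih fun j hj ↦ hg j (by omega)
    refine ⟨q.concat (hg m (by omega)), ?_⟩
    rw [Walk.support_concat, hq, List.range_succ (n := m + 1)]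
    simp

theorem HasPathSystem.hasDistinguishedPaths {t : ℕ}
    (h : HasPathSystem G k (2 * t * (k - 1) + 1)) : HasDistinguishedPaths G k t := by
  set m := 2 * t * (k - 1) + 1 with hm
  obtain ⟨f, hf⟩ := h
  have key : ∀ v i, ∃ (z : V) (q : G.Walk v z), v ∈ degreeClass G (k - 1) →
      q.support = (List.range (m + 1)).map (f v i) := by
    intro v i
    by_cases hv : v ∈ degreeClass G (k - 1)
    · obtain ⟨q, hq⟩ := exists_walk_support_eq (f v i) m ((hf v hv).2.1 i)
      exact ⟨_, q.copy ((hf v hv).1 i) rfl, fun _ ↦ by rw [Walk.support_copy, hq]⟩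
    · exact ⟨v, .nil, fun h ↦ absurd h hv⟩
  choose z q hq using key
  have hmem : ∀ v ∈ degreeClass G (k - 1), ∀ i x,
      x ∈ walkVerts (q v i) ↔ ∃ j ≤ m, f v i j = x := by
    intro v hv i x
    change x ∈ (q v i).support ↔ _
    rw [hq v i hv]
    simp
  refine ⟨z, q, fun v hv ↦ ?_⟩
  obtain ⟨h1, -, h3, h4⟩ := hf v hv
  have hnodup : ∀ i, (q v i).support.Nodup := by
    intro i
    rw [hq v i hv]
    refine (List.nodup_map_iff_inj_on List.nodup_range).2 fun j hj j' hj' hjj ↦ ?_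
    exact (h4 v hv i i j (by simpa [Nat.lt_succ_iff] using hj) j'
      (by simpa [Nat.lt_succ_iff] using hj') hjj).2.1
  have hstart : ∀ i, v ∈ walkVerts (q v i) := fun i ↦ (q v i).start_mem_support
  refine ⟨fun i ↦ (Walk.isPath_def _).2 (hnodup i), ?_, ?_, ?_, ?_⟩
  · intro i
    ext x
    rw [Set.mem_inter_iff, hmem v hv, Set.mem_singleton_iff]
    constructor
    · rintro ⟨⟨j, hj, rfl⟩, hx⟩
      by_cases hj0 : j = 0
      · rw [hj0, h1]
      · exact absurd hx (h3 i j hj hj0)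
    · rintro rfl
      exact ⟨⟨0, by omega, h1 i⟩, hv⟩
  · intro i
    have : walkVerts (q v i) = ((q v i).support.toFinset : Set V) := by
      ext x
      simp [walkVerts]
    rw [this, Set.ncard_coe_finset, List.toFinset_card_of_nodup (hnodup i), hq v i hv,
      List.length_map, List.length_range]
  · intro i i' hii
    ext x
    rw [Set.mem_inter_iff, Set.mem_singleton_iff]
    refine ⟨?_, by rintro rfl; exact ⟨hstart i, hstart i'⟩⟩
    rw [hmem v hv, hmem v hv]
    rintro ⟨⟨j, hj, rfl⟩, j', hj', hjj⟩
    obtain ⟨-, -, rfl | h⟩ := h4 v hv i i' j hj j' hj' hjj.symm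
    · exact h1 i
    · exact absurd h hii
  · intro w hw hwv i i'
    rw [Set.eq_empty_iff_forall_notMem]
    rintro x ⟨hx, hx'⟩
    rw [hmem v hv] at hx
    rw [hmem w hw] at hx'
    obtain ⟨j, hj, rfl⟩ := hx
    obtain ⟨j', hj', hjj⟩ := hx'
    exact hwv (h4 w hw i i' j hj j' hj' hjj.symm).1.symm

theorem hasPathSystem_one_meredith (hk : 0 < k) (hp : IsPortMap G p)
    (hmin : ∀ v, k - 1 ≤ G.degree v) : HasPathSystem (meredith G p) k 1 := by
  refine ⟨fun x i j ↦ if j = 0 then x else (x.1, .inr i), fun x hx ↦ ?_⟩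
  obtain ⟨a, hxa, ha⟩ := (mem_degreeClass_meredith hk hp).1 hx
  refine ⟨fun i ↦ rfl, ?_, ?_, ?_⟩
  · intro i j hj
    obtain rfl : j = 0 := by omega
    obtain ⟨v, b⟩ := x
    obtain rfl : b = .inl a := hxa
    simp
  · intro i j _ hj h
    simp only [if_neg hj] at h
    obtain ⟨b, hb, -⟩ := (mem_degreeClass_meredith hk hp).1 h
    simp at hb
  · intro y hy i i' j hj j' hj' heq
    obtain ⟨b, hyb, hb⟩ := (mem_degreeClass_meredith hk hp).1 hy
    have hxy : x.1 = y.1 → x = y := fun h ↦ by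
      refine Prod.ext h ?_
      rw [hxa, hyb, free_port_unique hp (hmin x.1) ha (by rwa [h])]
    dsimp only at heq
    split_ifs at heq with h h' h'
    · exact ⟨heq, by omega, .inl h⟩
    · rw [heq] at hxa
      simp at hxa
    · rw [← heq] at hyb
      simp at hyb
    · rw [Prod.mk.injEq, Sum.inr.injEq] at heq
      exact ⟨hxy heq.1, by omega, .inr heq.2⟩

/-- Lifting a system of paths to the Meredith extension. A vertex of degree `k - 1` in the
extension is the free port `x` of a block of a vertex of degree `k - 1` of `G`. Within every block
on its way, the lift of a path enters at the port of the previous edge, passes through one vertex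
of the smaller side and leaves at the port of the next edge. So the `(3 q + r)`-th vertex of the
lift is in the block of the `q`-th vertex of the path. -/
theorem HasPathSystem.meredith {m : ℕ} (hk : 0 < k) (hp : IsPortMap G p)
    (hmin : ∀ v, k - 1 ≤ G.degree v) (h : HasPathSystem G k m) :
    HasPathSystem (meredith G p) k (3 * m) := by
  obtain ⟨f, hf⟩ := h
  let F : V × (Fin k ⊕ Fin (k - 1)) → Fin (k - 1) → ℕ → V × (Fin k ⊕ Fin (k - 1)) := fun x i j ↦
    if j = 0 then x else (f x.1 i (j / 3),
      if j % 3 = 0 then .inl (p (f x.1 i (j / 3)) (f x.1 i (j / 3 - 1)))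
      else if j % 3 = 1 then .inr i
      else .inl (p (f x.1 i (j / 3)) (f x.1 i (j / 3 + 1))))
  have hF0 : ∀ x i, F x i 0 = x := fun x i ↦ rfl
  have hFin : ∀ x i q, F x i (3 * q + 3) =
      (f x.1 i (q + 1), .inl (p (f x.1 i (q + 1)) (f x.1 i q))) := by
    intro x i q
    have h1 : (3 * q + 3) / 3 = q + 1 := by omega
    have h2 : (3 * q + 3) % 3 = 0 := by omega
    simp [F, h1, h2]
  have hFmid : ∀ x i q, F x i (3 * q + 1) = (f x.1 i q, .inr i) := by
    intro x i q
    have h1 : (3 * q + 1) / 3 = q := by omega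
    have h2 : (3 * q + 1) % 3 = 1 := by omega
    simp [F, h1, h2]
  have hFout : ∀ x i q, F x i (3 * q + 2) =
      (f x.1 i q, .inl (p (f x.1 i q) (f x.1 i (q + 1)))) := by
    intro x i q
    have h1 : (3 * q + 2) / 3 = q := by omega
    have h2 : (3 * q + 2) % 3 = 2 := by omega
    simp [F, h1, h2]
  have hcases : ∀ j, j = 0 ∨ (∃ q, j = 3 * q + 3) ∨ (∃ q, j = 3 * q + 1) ∨ ∃ q, j = 3 * q + 2 := by
    intro j
    rcases (by omega : j = 0 ∨ (j % 3 = 0 ∧ j ≠ 0) ∨ j % 3 = 1 ∨ j % 3 = 2) with h | h | h | h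
    · exact .inl h
    · exact .inr (.inl ⟨j / 3 - 1, by omega⟩)
    · exact .inr (.inr (.inl ⟨j / 3, by omega⟩))
    · exact .inr (.inr (.inr ⟨j / 3, by omega⟩))
  have hbase : ∀ x, x ∈ degreeClass (EdgeCritical.meredith G p) (k - 1) →
      x.1 ∈ degreeClass G (k - 1) := by
    intro x hx
    obtain ⟨a, -, ha⟩ := (mem_degreeClass_meredith hk hp).1 hx
    have h1 := degree_lt_of_free_port hp ha
    have h2 := hmin x.1
    change G.degree x.1 = k - 1
    omega
  refine ⟨F, fun x hx ↦ ?_⟩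
  obtain ⟨a, hxa, ha⟩ := (mem_degreeClass_meredith hk hp).1 hx
  obtain ⟨h1, h2, -, h4⟩ := hf x.1 (hbase x hx)
  refine ⟨hF0 x, ?_, ?_, ?_⟩
  · intro i j hj
    rcases hcases j with rfl | ⟨q, rfl⟩ | ⟨q, rfl⟩ | ⟨q, rfl⟩
    · rw [hF0, hFmid x i 0, h1]
      obtain ⟨v, b⟩ := x
      obtain rfl : b = .inl a := hxa
      simp
    · rw [hFin, show 3 * q + 3 + 1 = 3 * (q + 1) + 1 by ring, hFmid]
      simp
    · rw [hFmid, hFout]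
      simp
    · rw [hFout, hFin]
      simpa using h2 i q (by omega)
  · intro i j hj hj0 hmem
    obtain ⟨b, hb, hfree⟩ := (mem_degreeClass_meredith hk hp).1 hmem
    rcases hcases j with rfl | ⟨q, rfl⟩ | ⟨q, rfl⟩ | ⟨q, rfl⟩
    · exact hj0 rfl
    · rw [hFin] at hb hfree
      exact hfree ⟨f x.1 i q, (h2 i q (by omega)).symm, Sum.inl_injective hb⟩
    · rw [hFmid] at hb
      simp at hb
    · rw [hFout] at hb hfree
      exact hfree ⟨f x.1 i (q + 1), h2 i q (by omega), Sum.inl_injective hb⟩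
  · intro y hy i i' j hj j' hj' heq
    obtain ⟨b, hyb, hb⟩ := (mem_degreeClass_meredith hk hp).1 hy
    have hxy : x.1 = y.1 → x = y := fun h ↦ by
      refine Prod.ext h ?_
      rw [hxa, hyb, free_port_unique hp (hmin x.1) ha (by rwa [h])]
    have hfst : ∀ z i j, z ∈ degreeClass (EdgeCritical.meredith G p) (k - 1) →
        (F z i j).1 = f z.1 i (j / 3) := by
      intro z i j hz
      by_cases h : j = 0
      · subst h
        exact ((hf z.1 (hbase z hz)).1 i).symm
      · simp [F, h]
    have h5 := congrArg Prod.fst heq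
    rw [hfst x i j hx, hfst y i' j' hy] at h5
    obtain ⟨h6, h7, h8⟩ := h4 y.1 (hbase y hy) i i' (j / 3) (by omega) (j' / 3) (by omega) h5
    obtain rfl := hxy h6
    -- Within the initial block the free port is distinct from all other vertices of the paths.
    have hfree : ∀ i j, j ≤ 3 * m → j ≠ 0 → F x i j ≠ x := by
      intro i j hj hj0 hjx
      have h5 := (hfst x i j hx).symm.trans ((congrArg Prod.fst hjx).trans (h1 i).symm)
      have h6 := (h4 x.1 (hbase x hx) i i (j / 3) (by omega) 0 (by omega) h5).2.1
      rcases (by omega : j = 3 * 0 + 1 ∨ j = 3 * 0 + 2) with rfl | rfl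
      · rw [hFmid] at hjx
        rw [← hjx] at hxa
        simp at hxa
      · rw [hFout, h1] at hjx
        have hadj := h2 i 0 (by omega)
        rw [h1] at hadj
        refine ha ⟨_, hadj, ?_⟩
        rw [← hjx] at hxa
        exact Sum.inl_injective hxa
    refine ⟨rfl, ?_⟩
    rcases hcases j with rfl | ⟨q, rfl⟩ | ⟨q, rfl⟩ | ⟨q, rfl⟩ <;>
      rcases hcases j' with rfl | ⟨q', rfl⟩ | ⟨q', rfl⟩ | ⟨q', rfl⟩
    · exact ⟨rfl, .inl rfl⟩
    · exact absurd heq.symm (hfree i' _ hj' (by omega))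
    · exact absurd heq.symm (hfree i' _ hj' (by omega))
    · exact absurd heq.symm (hfree i' _ hj' (by omega))
    · exact absurd heq (hfree i _ hj (by omega))
    · exact ⟨by omega, .inr (h8.resolve_left (by omega))⟩
    · rw [hFin, hFmid] at heq
      simp at heq
    · obtain rfl : q' = q + 1 := by omega
      obtain rfl : i = i' := h8.resolve_left (by omega)
      rw [hFin, hFout] at heq
      have h9 := hp _ _ _ (h2 i q (by omega)).symm (h2 i (q + 1) (by omega))
        (Sum.inl_injective (congrArg Prod.snd heq))
      have := (h4 x.1 (hbase x hx) i i q (by omega) (q + 1 + 1) (by omega) h9).2.1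
      omega
    · exact absurd heq (hfree i _ hj (by omega))
    · rw [hFin, hFmid] at heq
      simp at heq
    · rw [hFmid, hFmid] at heq
      exact ⟨by omega, .inr (Sum.inr_injective (congrArg Prod.snd heq))⟩
    · rw [hFmid, hFout] at heq
      simp at heq
    · exact absurd heq (hfree i _ hj (by omega))
    · obtain rfl : q = q' + 1 := by omega
      obtain rfl : i = i' := h8.resolve_left (by omega)
      rw [hFin, hFout] at heq
      have h9 := hp _ _ _ (h2 i (q' + 1) (by omega)) (h2 i q' (by omega)).symm
        (Sum.inl_injective (congrArg Prod.snd heq))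
      have := (h4 x.1 (hbase x hx) i i (q' + 1 + 1) (by omega) q' (by omega) h9).2.1
      omega
    · rw [hFmid, hFout] at heq
      simp at heq
    · obtain rfl : q = q' := by omega
      refine ⟨rfl, .inr ?_⟩
      rcases h8 with h8 | rfl
      · obtain rfl : q = 0 := by omega
        rw [hFout, hFout, h1, h1] at heq
        have hadj := h2 i 0 (by omega)
        have hadj' := h2 i' 0 (by omega)
        rw [h1] at hadj hadj'
        have h9 := hp _ _ _ hadj hadj' (Sum.inl_injective (congrArg Prod.snd heq))
        exact (h4 x.1 (hbase x hx) i i' 1 (by omega) 1 (by omega) h9).2.2.resolve_left (by omega)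
      · rfl

/-! ### The independence ratio -/

/-- Iterated Meredith extensions of a `k`-critical graph with independence ratio above `1 / 2`. -/
theorem exists_hasPathSystem (h : IsCritical G k) (hα : Fintype.card V < 2 * G.indepNum) (m : ℕ) :
    ∃ (W : Type u) (_ : Fintype W) (H : SimpleGraph W), IsCritical H k ∧
      Fintype.card W < 2 * H.indepNum ∧ (∀ v, k - 1 ≤ H.degree v) ∧ HasPathSystem H k (m + 1) := by
  have hk : 0 < k := by have := h.1; omega
  have step : ∀ {W : Type u} [Fintype W] {H : SimpleGraph W} (p : W → W → Fin k),
      Fintype.card W < 2 * H.indepNum →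
      Fintype.card (W × (Fin k ⊕ Fin (k - 1))) < 2 * (meredith H p).indepNum := by
    intro W _ H p hα
    have h1 := le_indepNum_meredith (G := H) (p := p) hk
    obtain ⟨n, rfl⟩ : ∃ n, k = n + 1 := ⟨k - 1, by omega⟩
    simp only [Fintype.card_prod, Fintype.card_sum, Fintype.card_fin, Nat.add_sub_cancel] at h1 ⊢
    nlinarith
  have hmin : ∀ {W : Type u} [Fintype W] {H : SimpleGraph W} {p : W → W → Fin k},
      IsPortMap H p → ∀ v, k - 1 ≤ (meredith H p).degree v := by
    intro W _ H p hp v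
    rcases degree_meredith hk hp v with h | h <;> omega
  induction m with
  | zero =>
    obtain ⟨p, hp⟩ := exists_isPortMap hk h.degree_le
    obtain ⟨p', hp'⟩ := exists_isPortMap hk (h.meredith hp).degree_le
    exact ⟨_, inferInstance, meredith (meredith G p) p', (h.meredith hp).meredith hp',
      step p' (step p hα), hmin hp', hasPathSystem_one_meredith hk hp' (hmin hp)⟩
  | succ m ih =>
    obtain ⟨W, _, H, hH, hα', hmin', hpath⟩ := ih
    obtain ⟨p, hp⟩ := exists_isPortMap hk hH.degree_le
    exact ⟨_, inferInstance, meredith H p, hH.meredith hp, step p hα', hmin hp,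
      (hpath.meredith hk hp hmin').mono (by omega)⟩

theorem indepRatio_le_half_iff {G : FinGraph.{u}} [Nonempty G.V] :
    indepRatio G ≤ 1 / 2 ↔ 2 * G.graph.indepNum ≤ Fintype.card G.V := by
  have : (0 : ℝ) < Fintype.card G.V := by exact_mod_cast Fintype.card_pos
  rw [indepRatio, div_le_iff₀ this, ← Nat.cast_le (α := ℝ)]
  push_cast
  constructor <;> intro h <;> linarith

/-- Counting the edges between an independent set and its complement. -/
theorem two_mul_indepNum_le (hmax : ∀ v, G.degree v ≤ k) (hmin : ∀ v, k - 1 ≤ G.degree v) :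
    2 * k * G.indepNum ≤ k * Fintype.card V + (degreeClass G (k - 1)).ncard := by
  obtain ⟨I, hI⟩ := G.exists_isNIndepSet_indepNum
  have hD : (degreeClass G (k - 1)).ncard =
      (Finset.univ.filter fun v ↦ G.degree v = k - 1).card := by
    rw [← Set.ncard_coe_finset]
    congr 1
    ext v
    simp [degreeClass]
  have h1 : ∑ v ∈ I, G.degree v ≤ ∑ w ∈ Iᶜ, G.degree w := by
    have h := Finset.sum_card_bipartiteAbove_eq_sum_card_bipartiteBelow (s := I) (t := Iᶜ) G.Adj
    calc ∑ v ∈ I, G.degree v = ∑ v ∈ I, (Finset.bipartiteAbove G.Adj Iᶜ v).card := by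
          refine Finset.sum_congr rfl fun v hv ↦ ?_
          rw [← card_neighborFinset_eq_degree]
          congr 1
          ext w
          simp only [mem_neighborFinset, Finset.mem_bipartiteAbove, Finset.mem_compl]
          exact ⟨fun h ↦ ⟨fun hw ↦ hI.isIndepSet hv hw h.ne h, h⟩, fun h ↦ h.2⟩
      _ = _ := h
      _ ≤ ∑ w ∈ Iᶜ, G.degree w := by
          refine Finset.sum_le_sum fun w _ ↦ ?_
          rw [← card_neighborFinset_eq_degree]
          refine Finset.card_le_card fun v hv ↦ ?_
          rw [Finset.mem_bipartiteBelow] at hv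
          simpa using hv.2.symm
  have h2 : ∑ w ∈ Iᶜ, G.degree w ≤ Iᶜ.card * k := by
    simpa using Finset.sum_le_card_nsmul Iᶜ (fun w ↦ G.degree w) k fun w _ ↦ hmax w
  have h3 : I.card * k ≤
      ∑ v ∈ I, G.degree v + (Finset.univ.filter fun v ↦ G.degree v = k - 1).card := by
    calc I.card * k = ∑ v ∈ I, k := by simp
      _ ≤ ∑ v ∈ I, (G.degree v + if G.degree v = k - 1 then 1 else 0) := by
          refine Finset.sum_le_sum fun v _ ↦ ?_
          have := hmin v
          split_ifs <;> omega
      _ = ∑ v ∈ I, G.degree v + (I.filter fun v ↦ G.degree v = k - 1).card := by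
          rw [Finset.sum_add_distrib, Finset.card_filter]
      _ ≤ _ := by
          gcongr
          exact Finset.subset_univ I
  have h4 : I.card + Iᶜ.card = Fintype.card V := Finset.card_add_card_compl I
  rw [hD, ← h4, ← hI.card_eq]
  nlinarith

/-- One distinguished path at each vertex of degree `k - 1` suffices to show that such vertices
are rare. -/
theorem ncard_degreeClass_mul_le {t : ℕ} (hk : 2 ≤ k) (h : HasDistinguishedPaths G k t) :
    (degreeClass G (k - 1)).ncard * (2 * t + 2) ≤ Fintype.card V := by
  obtain ⟨z, q, hq⟩ := h
  let i : Fin (k - 1) := ⟨0, by omega⟩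
  let S : V → Finset V := fun v ↦ (q v i).support.toFinset
  have hS : ∀ v, (S v : Set V) = walkVerts (q v i) := by
    intro v
    ext x
    simp [S, walkVerts]
  rw [Set.ncard_eq_toFinset_card', ← Finset.card_univ]
  have hdisj : ((degreeClass G (k - 1)).toFinset : Set V).PairwiseDisjoint S := by
    intro v hv w hw hvw
    rw [Set.coe_toFinset] at hv hw
    rw [Function.onFun, ← Finset.disjoint_coe, hS, hS, Set.disjoint_iff_inter_eq_empty]
    exact (hq v hv).2.2.2.2 w hw hvw.symm i i
  calc _ ≤ ∑ v ∈ (degreeClass G (k - 1)).toFinset, (S v).card := by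
        rw [← smul_eq_mul]
        refine Finset.card_nsmul_le_sum _ _ _ fun v hv ↦ ?_
        rw [← Set.ncard_coe_finset, hS]
        refine le_trans ?_ ((hq v (by simpa using hv)).2.2.1 i)
        have : 1 ≤ k - 1 := by omega
        nlinarith
    _ = ((degreeClass G (k - 1)).toFinset.biUnion S).card := (Finset.card_biUnion hdisj).symm
    _ ≤ _ := Finset.card_le_univ _

/-- The independence number exceeds `n / 2` by at most `d / (2 k)`, where `d` is the number of
vertices of degree `k - 1`, and `d (2 t + 2) ≤ n`. The resulting bound on the excess of the ratio
does not depend on `k`. -/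
theorem indepRatio_lt {ε : ℝ} (hε : 0 < ε) {t : ℕ} (ht : 1 / ε ≤ t) {G : FinGraph.{u}}
    (hk : 2 ≤ k) (hG : G ∈ criticalPathClass k t) : indepRatio G < 1 / 2 + ε := by
  obtain ⟨hcrit, hmin, hpaths⟩ := hG
  change IsCritical G.graph k at hcrit
  have := hcrit.nonempty
  have h1 := two_mul_indepNum_le hcrit.degree_le fun v ↦ hmin.trans (G.graph.minDegree_le_degree v)
  have h2 := ncard_degreeClass_mul_le hk hpaths
  set D := (degreeClass G.graph (k - 1)).ncard
  set n := Fintype.card G.V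
  have hn : (0 : ℝ) < n := by exact_mod_cast Fintype.card_pos
  rw [indepRatio, div_lt_iff₀ hn]
  have h1' : 2 * (k : ℝ) * G.graph.indepNum ≤ k * n + D := by exact_mod_cast h1
  have h2' : (D : ℝ) * (2 * t + 2) ≤ n := by exact_mod_cast h2
  have hk' : (2 : ℝ) ≤ k := by exact_mod_cast hk
  have h3 : 1 ≤ ε * t := by rwa [div_le_iff₀ hε, mul_comm] at ht
  have hD : (D : ℝ) ≤ ε * n := by
    have hD0 : (0 : ℝ) ≤ D := Nat.cast_nonneg D
    calc (D : ℝ) ≤ D * (ε * t) := le_mul_of_one_le_right hD0 h3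
      _ ≤ ε * (D * (2 * t + 2)) := by
        have : 0 ≤ ε * D * (t + 2) := by positivity
        linarith
      _ ≤ ε * n := by gcongr
  have h4 : ε * n < 2 * k * (ε * n) := lt_mul_of_one_lt_left (by positivity) (by linarith)
  have h5 : 2 * (k : ℝ) * G.graph.indepNum < 2 * k * ((1 / 2 + ε) * n) := by linarith
  exact lt_of_mul_lt_mul_left h5 (by positivity)

theorem exists_mem_criticalPathClass {G : FinGraph.{u}} (hG : G ∈ criticalClass k)
    (hα : Fintype.card G.V < 2 * G.graph.indepNum) (t : ℕ) :
    ∃ H : FinGraph.{u}, H ∈ criticalPathClass k t ∧ Fintype.card H.V < 2 * H.graph.indepNum := by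
  obtain ⟨W, _, H, hH, hα', hmin, hpaths⟩ := exists_hasPathSystem hG hα (2 * t * (k - 1))
  have := hH.nonempty
  exact ⟨⟨W, H⟩, ⟨hH, le_minDegree_of_forall_le_degree _ _ hmin,
    hpaths.hasDistinguishedPaths⟩, hα'⟩

end EdgeCritical

theorem mainTheorem1 (ε : ℝ) (hε : 0 < ε) :
    ∃ T : ℕ, ∀ t ≥ T, ∃ Cε : Set EdgeCritical.FinGraph.{u},
      Cε = (⋃ k ≥ 2, EdgeCritical.criticalPathClass k t) ∧
      Cε ⊆ EdgeCritical.criticalGraphs ∧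
      ((∀ G ∈ (EdgeCritical.criticalGraphs : Set EdgeCritical.FinGraph.{u}),
          EdgeCritical.indepRatio G ≤ 1 / 2) ↔
        ∀ G ∈ Cε, EdgeCritical.indepRatio G ≤ 1 / 2) ∧
      ∀ G ∈ Cε, EdgeCritical.indepRatio G < 1 / 2 + ε := by
  obtain ⟨T, hT⟩ := exists_nat_ge (1 / ε)
  refine ⟨T, fun t ht ↦ ⟨_, rfl, ?_, ⟨?_, ?_⟩, ?_⟩⟩
  · exact Set.iUnion₂_mono fun k _ G hG ↦ hG.1
  · exact fun h G hG ↦ h G (Set.iUnion₂_mono (fun k _ G hG ↦ hG.1) hG)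
  · intro h G hG
    obtain ⟨k, hk, hG⟩ := Set.mem_iUnion₂.1 hG
    have := EdgeCritical.IsCritical.nonempty hG
    by_contra hlt
    rw [EdgeCritical.indepRatio_le_half_iff, not_le] at hlt
    obtain ⟨H, hH, hα⟩ := EdgeCritical.exists_mem_criticalPathClass hG hlt t
    have := EdgeCritical.IsCritical.nonempty hH.1
    exact hα.not_ge (EdgeCritical.indepRatio_le_half_iff.1
      (h H (Set.mem_iUnion₂.2 ⟨k, hk, hH⟩)))
  · intro G hG
    obtain ⟨k, hk, hG⟩ := Set.mem_iUnion₂.1 hG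
    exact EdgeCritical.indepRatio_lt hε (hT.trans (by exact_mod_cast ht)) hk hG
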